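/- Let $M$ be a von Neumann algebra equipped with a faithful normal trace $\tau$ satisfying $\tau(1)=1$ (so $M$ is finite), and let $B\subseteq M$ be a von Neumann subalgebra with the same unit as $M$. Let $L^2(M)=L^2(M,\tau)$ be the completion of $M$ in the inner product $\langle x,y\rangle=\tau(x^*y)$, on which $M$ acts by left multiplication, and let $\xi\in L^2(M)$ be the image of $1\in M$. Let $e_B$ be the orthogonal projection of $L^2(M)$ onto the closed subspace $L^2(B)=\overline{B\xi}$, and let $\langle M,e_B\rangle$ be the von Neumann algebra on $L^2(M)$ generated by $M$ and $e_B$. Then $e_B$ is a central element of $B'\cap\langle M,e_B\rangle$ if and only if $B'\cap M\subseteq B$. -/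

import Mathlib

open scoped InnerProductSpace ComplexOrder

noncomputable section

namespace VonNeumannAlgebra

variable {K : Type*} [NormedAddCommGroup K] [InnerProductSpace ℂ K] [CompleteSpace K]

/-! ### A von Neumann algebra as a C⋆-algebra, with the usual order of operators -/

instance instSMulMemClass : SMulMemClass (VonNeumannAlgebra K) ℂ (K →L[ℂ] K) where
  smul_mem {s} c _ hx := s.toStarSubalgebra.smul_mem hx c

instance instIsClosed (M : VonNeumannAlgebra K) : IsClosed (M : Set (K →L[ℂ] K)) := by
  rw [← M.centralizer_centralizer]
  exact Set.isClosed_centralizer _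

instance instStarOrderedRing (M : VonNeumannAlgebra K) : StarOrderedRing M :=
  StarOrderedRing.of_nonneg_iff' (fun {x y} h z ↦ add_le_add_right (α := K →L[ℂ] K) h z)
    fun x ↦ by
      constructor
      · intro hx
        have hx' : (0 : K →L[ℂ] K) ≤ x := hx
        have hs : CFC.sqrt (x : K →L[ℂ] K) ∈ M := by
          suffices h : CFC.sqrt (x : K →L[ℂ] K) ∈ M.commutant.commutant from
            (SetLike.ext_iff.1 M.commutant_commutant _).1 h
          rw [mem_commutant_iff]
          intro g hg
          have hc : Commute (x : K →L[ℂ] K) g := mem_commutant_iff.1 hg x x.2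
          exact (hc.cfcₙ_nnreal NNReal.sqrt).symm
        refine ⟨⟨_, hs⟩, Subtype.ext ?_⟩
        have h0 : 0 ≤ CFC.sqrt (x : K →L[ℂ] K) := CFC.sqrt_nonneg _
        change (x : K →L[ℂ] K) = star (CFC.sqrt (x : K →L[ℂ] K)) * CFC.sqrt (x : K →L[ℂ] K)
        rw [(IsSelfAdjoint.of_nonneg h0).star_eq, CFC.sqrt_mul_sqrt_self _ hx']
      · rintro ⟨s, rfl⟩
        change (0 : K →L[ℂ] K) ≤ star (s : K →L[ℂ] K) * s
        exact star_mul_self_nonneg _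

/-! ### Generated von Neumann algebras -/

/-- The von Neumann algebra generated by a set `S` of operators: the double commutant of
`S ∪ S*`. -/
def generatedBy (S : Set (K →L[ℂ] K)) : VonNeumannAlgebra K where
  toStarSubalgebra := StarSubalgebra.centralizer ℂ (StarSubalgebra.centralizer ℂ S : Set (K →L[ℂ] K))
  centralizer_centralizer' := by
    change Set.centralizer (Set.centralizer (StarSubalgebra.centralizer ℂ
      (StarSubalgebra.centralizer ℂ S : Set (K →L[ℂ] K)) : Set (K →L[ℂ] K))) =
      (StarSubalgebra.centralizer ℂ (StarSubalgebra.centralizer ℂ S : Set (K →L[ℂ] K)) :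
        Set (K →L[ℂ] K))
    rw [StarSubalgebra.coe_centralizer_centralizer, Set.centralizer_centralizer_centralizer]

/-- `generatedBy S` is the smallest von Neumann algebra containing `S`. -/
theorem isLeast_generatedBy (S : Set (K →L[ℂ] K)) :
    IsLeast {N : VonNeumannAlgebra K | S ⊆ N} (generatedBy S) := by
  have key : (generatedBy S : Set (K →L[ℂ] K)) = (S ∪ star S).centralizer.centralizer :=
    StarSubalgebra.coe_centralizer_centralizer ℂ S
  refine ⟨?_, fun N hN ↦ ?_⟩
  · change S ⊆ (generatedBy S : Set (K →L[ℂ] K))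
    rw [key]
    exact Set.subset_union_left.trans Set.subset_centralizer_centralizer
  · change (generatedBy S : Set (K →L[ℂ] K)) ⊆ N
    rw [key, ← N.centralizer_centralizer]
    refine Set.centralizer_subset (Set.centralizer_subset (Set.union_subset hN fun x hx ↦ ?_))
    have h : star x ∈ N := hN hx
    simpa using star_mem h

/-! ### Traces -/

/-- A linear functional on `M` is normal (σ-weakly continuous) if it has the form
`x ↦ ∑ₙ ⟨ηₙ, x ζₙ⟩` with `∑ₙ ‖ηₙ‖² < ∞` and `∑ₙ ‖ζₙ‖² < ∞`. -/
def IsNormal {M : VonNeumannAlgebra K} (φ : M →ₗ[ℂ] ℂ) : Prop :=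
  ∃ η ζ : ℕ → K, (Summable fun n ↦ ‖η n‖ ^ 2) ∧ (Summable fun n ↦ ‖ζ n‖ ^ 2) ∧
    ∀ x : M, HasSum (fun n ↦ ⟪η n, (x : K →L[ℂ] K) (ζ n)⟫_ℂ) (φ x)

/-- A faithful normal trace `τ` on `M` with `τ 1 = 1`. -/
structure IsFaithfulNormalTrace {M : VonNeumannAlgebra K} (τ : M →ₚ[ℂ] ℂ) : Prop where
  map_one : τ 1 = 1
  map_mul_comm : ∀ x y : M, τ (x * y) = τ (y * x)
  faithful : ∀ x : M, τ (star x * x) = 0 → x = 0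
  normal : IsNormal τ.toLinearMap

/-! ### The basic construction

`L²(M, τ)` is `τ.GNS`, the completion of `M` in the inner product `⟨x, y⟩ = τ (x* y)`, on which
`M` acts by left multiplication, through `τ.gnsStarAlgHom`. -/

variable {M : VonNeumannAlgebra K}

/-- The canonical map `M → L²(M, τ)`, written `x ↦ x ξ` with `ξ` the image of `1`. -/
def toL2 (τ : M →ₚ[ℂ] ℂ) : M →ₗ[ℂ] τ.GNS :=
  (UniformSpace.Completion.toComplL (𝕜 := ℂ) (E := τ.PreGNS)).toLinearMap ∘ₗ
    τ.toPreGNS.toLinearMap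

/-- The operators on `L²(M, τ)` of left multiplication by the elements of `B ∩ M`. -/
def leftMul (τ : M →ₚ[ℂ] ℂ) (B : VonNeumannAlgebra K) : Set (τ.GNS →L[ℂ] τ.GNS) :=
  {T | ∃ x : M, (x : K →L[ℂ] K) ∈ B ∧ τ.gnsStarAlgHom x = T}

/-- `L²(B)` as a closed subspace of `L²(M, τ)`, the closure of the span of `{b ξ | b ∈ B}`. -/
def subL2 (τ : M →ₚ[ℂ] ℂ) (B : VonNeumannAlgebra K) : Submodule ℂ τ.GNS :=
  (Submodule.span ℂ {v | ∃ x : M, (x : K →L[ℂ] K) ∈ B ∧ toL2 τ x = v}).topologicalClosure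

instance (τ : M →ₚ[ℂ] ℂ) (B : VonNeumannAlgebra K) : CompleteSpace (subL2 τ B) :=
  (Submodule.isClosed_topologicalClosure _).completeSpace_coe

/-- The Jones projection `e_B`, the orthogonal projection of `L²(M, τ)` onto `L²(B)`. -/
def jonesProjection (τ : M →ₚ[ℂ] ℂ) (B : VonNeumannAlgebra K) : τ.GNS →L[ℂ] τ.GNS :=
  (subL2 τ B).starProjection

/-- The basic construction `⟨M, e_B⟩`, the von Neumann algebra on `L²(M, τ)` generated by `M`
and `e_B`. -/
def basicConstruction (τ : M →ₚ[ℂ] ℂ) (B : VonNeumannAlgebra K) : VonNeumannAlgebra τ.GNS :=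
  generatedBy (leftMul τ M ∪ {jonesProjection τ B})

/-- The relative commutant `B' ∩ ⟨M, e_B⟩`. -/
def relCommutantBasic (τ : M →ₚ[ℂ] ℂ) (B : VonNeumannAlgebra K) :
    StarSubalgebra ℂ (τ.GNS →L[ℂ] τ.GNS) :=
  StarSubalgebra.centralizer ℂ (leftMul τ B) ⊓ (basicConstruction τ B).toStarSubalgebra

/-- `e` is a central element of the algebra `N`. -/
def IsCentralIn {A : Type*} [Ring A] [StarRing A] [Algebra ℂ A] [StarModule ℂ A] (e : A)
    (N : StarSubalgebra ℂ A) : Prop :=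
  e ∈ N ∧ ∀ t ∈ N, e * t = t * e

end VonNeumannAlgebra

end

noncomputable section

namespace VonNeumannAlgebra

variable {K : Type*} [NormedAddCommGroup K] [InnerProductSpace ℂ K] [CompleteSpace K]
  {M : VonNeumannAlgebra K}

/-! ### The standard vectors `x ξ` of `L²(M, τ)` -/

/-! If `e_B` is central, then for `x ∈ B' ∩ M` it commutes with left multiplication by `x`; since
`e_B ξ = ξ`, this gives `e_B x ξ = x ξ`, so `x ξ ∈ L²(B)`, and `mem_of_toL2_mem_subL2` yields `x ∈
B`.

Conversely, `t ∈ B' ∩ ⟨M, e_B⟩` commutes with left and right multiplication by `B`, so `t ξ` is a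
`B`-central vector. Averaging over the unitaries of `B` (`mem_closure_of_central`) puts it in the
closure of `(B' ∩ M) ξ`, hence in `L²(B)` by hypothesis. Then `t b ξ = b t ξ ∈ L²(B)`. The same
holds for `t*`, so `t` commutes with `e_B`.

The analytic difficulty is that `M` acts on an arbitrary `K`, not on `L²(M, τ)`. Normality supplies
a dense space of vectors `ω ∈ K` for which `x ξ ↦ x ω` is bounded, so `L²`-limits can be tested on
`K`. -/

theorem inner_toL2 (τ : M →ₚ[ℂ] ℂ) (x y : M) :
    ⟪toL2 τ x, toL2 τ y⟫_ℂ = τ (star x * y) :=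
  UniformSpace.Completion.inner_coe _ _

theorem denseRange_toL2 (τ : M →ₚ[ℂ] ℂ) : DenseRange (toL2 τ) :=
  UniformSpace.Completion.denseRange_coe.comp τ.toPreGNS.surjective.denseRange
    (UniformSpace.Completion.continuous_coe _)

theorem gnsStarAlgHom_toL2 (τ : M →ₚ[ℂ] ℂ) (x y : M) :
    τ.gnsStarAlgHom x (toL2 τ y) = toL2 τ (x * y) :=
  τ.gnsNonUnitalStarAlgHom_apply_coe

theorem norm_toL2_mul_le (τ : M →ₚ[ℂ] ℂ) (x y : M) :
    ‖toL2 τ (x * y)‖ ≤ ‖x‖ * ‖toL2 τ y‖ := by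
  rw [← gnsStarAlgHom_toL2]
  refine (ContinuousLinearMap.le_opNorm _ _).trans ?_
  gcongr
  exact NonUnitalStarAlgHom.norm_apply_le τ.gnsStarAlgHom x

/-- Two bounded operators on `L²(M, τ)` that agree on `M ξ` are equal. -/
theorem ext_toL2 {τ : M →ₚ[ℂ] ℂ} {F : Type*} [NormedAddCommGroup F] [NormedSpace ℂ F]
    {S T : τ.GNS →L[ℂ] F} (h : ∀ x, S (toL2 τ x) = T (toL2 τ x)) : S = T :=
  ContinuousLinearMap.ext fun v ↦ congrFun
    ((denseRange_toL2 τ).equalizer S.continuous T.continuous (funext h)) v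

theorem inner_toL2_eq_zero {τ : M →ₚ[ℂ] ℂ} {v : τ.GNS} (h : ∀ x, ⟪toL2 τ x, v⟫_ℂ = 0) :
    v = 0 := by
  refine (denseRange_toL2 τ).eq_zero_of_inner_left ℂ fun x ↦ ?_
  rw [← inner_conj_symm, h, map_zero]

theorem eq_zero_of_toL2_eq_zero {τ : M →ₚ[ℂ] ℂ} (hτ : IsFaithfulNormalTrace τ) {x : M}
    (h : toL2 τ x = 0) : x = 0 := by
  refine hτ.faithful x ?_
  rw [← inner_toL2, h, inner_zero_left]

/-- The trace property `τ (x x*) = τ (x* x)`. It makes right multiplication bounded and lets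
adjoints pass to `L²`-limits. -/
theorem norm_toL2_star {τ : M →ₚ[ℂ] ℂ} (hτ : IsFaithfulNormalTrace τ) (x : M) :
    ‖toL2 τ (star x)‖ = ‖toL2 τ x‖ := by
  rw [← sq_eq_sq₀ (norm_nonneg _) (norm_nonneg _), ← Complex.ofReal_inj]
  push_cast
  have h (y : M) : ((‖toL2 τ y‖ : ℂ)) ^ 2 = τ (star y * y) := by
    rw [← inner_toL2, inner_self_eq_norm_sq_to_K]; rfl
  rw [h, h, star_star, hτ.map_mul_comm]

/-! ### Right multiplication -/

/-- Right multiplication by an element of `M`, as an operator on `L²(M, τ)`. -/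
def rightMul (τ : M →ₚ[ℂ] ℂ) (b : M) : τ.GNS →L[ℂ] τ.GNS :=
  (toL2 τ ∘ₗ LinearMap.mulRight ℂ b).extendOfNorm (toL2 τ)

theorem norm_toL2_mul_right_le {τ : M →ₚ[ℂ] ℂ} (hτ : IsFaithfulNormalTrace τ) (x b : M) :
    ‖toL2 τ (x * b)‖ ≤ ‖b‖ * ‖toL2 τ x‖ := by
  rw [← norm_toL2_star hτ (x * b), ← norm_toL2_star hτ x, star_mul, ← norm_star b]
  exact norm_toL2_mul_le τ _ _

/-- The extension defining `rightMul` has this value only because of the norm bound, which rests on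
the trace property. -/
theorem rightMul_toL2 {τ : M →ₚ[ℂ] ℂ} (hτ : IsFaithfulNormalTrace τ) (x b : M) :
    rightMul τ b (toL2 τ x) = toL2 τ (x * b) :=
  LinearMap.extendOfNorm_eq (f := toL2 τ ∘ₗ LinearMap.mulRight ℂ b) (denseRange_toL2 τ)
    ⟨‖b‖, fun x ↦ norm_toL2_mul_right_le hτ x b⟩ x

theorem star_rightMul {τ : M →ₚ[ℂ] ℂ} (hτ : IsFaithfulNormalTrace τ) (b : M) :
    star (rightMul τ b) = rightMul τ (star b) := by
  refine ext_toL2 fun x ↦ ?_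
  rw [← sub_eq_zero]
  refine inner_toL2_eq_zero fun y ↦ ?_
  rw [inner_sub_right, ContinuousLinearMap.star_eq_adjoint,
    ContinuousLinearMap.adjoint_inner_right, rightMul_toL2 hτ, rightMul_toL2 hτ, inner_toL2,
    inner_toL2, star_mul, mul_assoc, hτ.map_mul_comm, mul_assoc, sub_self]

theorem rightMul_comm_gns {τ : M →ₚ[ℂ] ℂ} (hτ : IsFaithfulNormalTrace τ) (x b : M) :
    τ.gnsStarAlgHom x * rightMul τ b = rightMul τ b * τ.gnsStarAlgHom x := by
  refine ext_toL2 fun y ↦ ?_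
  simp only [mul_apply_eq_comp, rightMul_toL2 hτ, gnsStarAlgHom_toL2, mul_assoc]

/-! ### The subspace `L²(B)` -/

/-- `B ξ` is already a subspace, so vectors of `L²(B)` are limits of vectors `b ξ`, with no linear
combinations. -/
theorem subL2_eq (τ : M →ₚ[ℂ] ℂ) (B : VonNeumannAlgebra K) :
    (subL2 τ B : Set τ.GNS) = closure (toL2 τ '' {x | (x : K →L[ℂ] K) ∈ B}) := by
  have h : Submodule.span ℂ {v | ∃ x : M, (x : K →L[ℂ] K) ∈ B ∧ toL2 τ x = v} =
      (B.toStarSubalgebra.toSubalgebra.toSubmodule.comap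
        (M.toStarSubalgebra.toSubalgebra.toSubmodule.subtype)).map (toL2 τ) :=
    (Submodule.span_eq _ : Submodule.span ℂ (Submodule.map (toL2 τ)
      (B.toStarSubalgebra.toSubalgebra.toSubmodule.comap
        (M.toStarSubalgebra.toSubalgebra.toSubmodule.subtype)) : Set τ.GNS) = _)
  rw [subL2, h, Submodule.topologicalClosure_coe]
  rfl

theorem toL2_mem_subL2 (τ : M →ₚ[ℂ] ℂ) {B : VonNeumannAlgebra K} {x : M}
    (hx : (x : K →L[ℂ] K) ∈ B) : toL2 τ x ∈ subL2 τ B :=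
  Submodule.le_topologicalClosure _ (Submodule.subset_span ⟨x, hx, rfl⟩)

theorem toL2_one_mem_subL2 (τ : M →ₚ[ℂ] ℂ) (B : VonNeumannAlgebra K) :
    toL2 τ 1 ∈ subL2 τ B := by
  refine toL2_mem_subL2 τ ?_
  change (1 : K →L[ℂ] K) ∈ B
  exact one_mem B

theorem jonesProjection_eq_self_iff {τ : M →ₚ[ℂ] ℂ} {B : VonNeumannAlgebra K} {v : τ.GNS} :
    jonesProjection τ B v = v ↔ v ∈ subL2 τ B :=
  Submodule.starProjection_eq_self_iff

theorem map_mem_subL2 {τ : M →ₚ[ℂ] ℂ} {B : VonNeumannAlgebra K} {T : τ.GNS →L[ℂ] τ.GNS}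
    (h : ∀ x : M, (x : K →L[ℂ] K) ∈ B → T (toL2 τ x) ∈ subL2 τ B) {v : τ.GNS}
    (hv : v ∈ subL2 τ B) : T v ∈ subL2 τ B := by
  rw [← SetLike.mem_coe, subL2_eq] at hv
  have hc : IsClosed (subL2 τ B : Set τ.GNS) := Submodule.isClosed_topologicalClosure _
  refine closure_minimal ?_ (hc.preimage T.continuous) hv
  rintro _ ⟨x, hx, rfl⟩
  exact h x hx

/-- A bounded operator commutes with the projection onto a subspace that it and its adjoint
leave invariant. -/
theorem starProjection_comm {H : Type*} [NormedAddCommGroup H] [InnerProductSpace ℂ H]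
    [CompleteSpace H] {U : Submodule ℂ H} [U.HasOrthogonalProjection] {T : H →L[ℂ] H}
    (h : ∀ v ∈ U, T v ∈ U) (h' : ∀ v ∈ U, star T v ∈ U) :
    U.starProjection * T = T * U.starProjection := by
  ext v
  simp only [mul_apply_eq_comp]
  refine Submodule.eq_starProjection_of_mem_of_inner_eq_zero (h _ (U.starProjection_apply_mem v))
    fun w hw ↦ ?_
  rw [← map_sub, ← ContinuousLinearMap.adjoint_inner_right]
  exact Submodule.starProjection_inner_eq_zero v _ (h' w hw)

theorem jonesProjection_comm {τ : M →ₚ[ℂ] ℂ} {B : VonNeumannAlgebra K}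
    {T : τ.GNS →L[ℂ] τ.GNS}
    (h : ∀ x : M, (x : K →L[ℂ] K) ∈ B → T (toL2 τ x) ∈ subL2 τ B)
    (h' : ∀ x : M, (x : K →L[ℂ] K) ∈ B → star T (toL2 τ x) ∈ subL2 τ B) :
    jonesProjection τ B * T = T * jonesProjection τ B :=
  starProjection_comm (fun _ hv ↦ map_mem_subL2 h hv) fun _ hv ↦ map_mem_subL2 h' hv

theorem jonesProjection_comm_gns (τ : M →ₚ[ℂ] ℂ) {B : VonNeumannAlgebra K} {b : M}
    (hb : (b : K →L[ℂ] K) ∈ B) :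
    jonesProjection τ B * τ.gnsStarAlgHom b = τ.gnsStarAlgHom b * jonesProjection τ B := by
  refine jonesProjection_comm (fun x hx ↦ ?_) fun x hx ↦ ?_
  · rw [gnsStarAlgHom_toL2]
    exact toL2_mem_subL2 τ (mul_mem hb hx)
  · rw [← map_star, gnsStarAlgHom_toL2]
    exact toL2_mem_subL2 τ (mul_mem (star_mem hb) hx)

theorem jonesProjection_comm_rightMul {τ : M →ₚ[ℂ] ℂ} (hτ : IsFaithfulNormalTrace τ)
    {B : VonNeumannAlgebra K} {b : M} (hb : (b : K →L[ℂ] K) ∈ B) :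
    jonesProjection τ B * rightMul τ b = rightMul τ b * jonesProjection τ B := by
  refine jonesProjection_comm (fun x hx ↦ ?_) fun x hx ↦ ?_
  · rw [rightMul_toL2 hτ]
    exact toL2_mem_subL2 τ (mul_mem hx hb)
  · rw [star_rightMul hτ, rightMul_toL2 hτ]
    exact toL2_mem_subL2 τ (mul_mem hx (star_mem hb))

theorem subset_basicConstruction (τ : M →ₚ[ℂ] ℂ) (B : VonNeumannAlgebra K) :
    leftMul τ M ∪ {jonesProjection τ B} ⊆ basicConstruction τ B :=
  (isLeast_generatedBy _).1

theorem jonesProjection_mem_relCommutantBasic (τ : M →ₚ[ℂ] ℂ) (B : VonNeumannAlgebra K) :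
    jonesProjection τ B ∈ relCommutantBasic τ B := by
  refine ⟨?_, subset_basicConstruction τ B (Or.inr rfl)⟩
  change _ ∈ StarSubalgebra.centralizer ℂ (leftMul τ B)
  rw [StarSubalgebra.mem_centralizer_iff]
  rintro _ ⟨b, hb, rfl⟩
  refine ⟨(jonesProjection_comm_gns τ hb).symm, ?_⟩
  rw [← map_star]
  exact (jonesProjection_comm_gns τ (b := star b) (star_mem hb)).symm

/-- `⟨M, e_B⟩` commutes with right multiplication by `B`. -/
theorem rightMul_comm_basicConstruction {τ : M →ₚ[ℂ] ℂ} (hτ : IsFaithfulNormalTrace τ)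
    {B : VonNeumannAlgebra K} {b : M} (hb : (b : K →L[ℂ] K) ∈ B) {t : τ.GNS →L[ℂ] τ.GNS}
    (ht : t ∈ basicConstruction τ B) : rightMul τ b * t = t * rightMul τ b := by
  change t ∈ StarSubalgebra.centralizer ℂ _ at ht
  rw [StarSubalgebra.mem_centralizer_iff] at ht
  -- As `⟨M, e_B⟩` is a double commutant, it is enough to commute with the generators and their
  -- adjoints.
  refine (ht _ ?_).1
  rw [SetLike.mem_coe, StarSubalgebra.mem_centralizer_iff]
  rintro _ (⟨x, -, rfl⟩ | rfl)
  · rw [← map_star]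
    exact ⟨rightMul_comm_gns hτ x b, rightMul_comm_gns hτ (star x) b⟩
  · have h : star (jonesProjection τ B) = jonesProjection τ B :=
      (isSelfAdjoint_starProjection (subL2 τ B)).star_eq
    rw [h]
    exact ⟨jonesProjection_comm_rightMul hτ hb, jonesProjection_comm_rightMul hτ hb⟩

/-! ### Bounded vectors -/

theorem mem_of_commutant_comm {N : VonNeumannAlgebra K} {x : K →L[ℂ] K}
    (h : ∀ T ∈ N.commutant, T * x = x * T) : x ∈ N := by
  rwa [← N.commutant_commutant, mem_commutant_iff]

/-- The vectors `ω` of `K` for which `x ξ ↦ x ω` is bounded on `M ξ`. -/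
def boundedVectors (τ : M →ₚ[ℂ] ℂ) : Submodule ℂ K where
  carrier := {ω | ∃ C : ℝ, ∀ x : M, ‖(x : K →L[ℂ] K) ω‖ ≤ C * ‖toL2 τ x‖}
  zero_mem' := ⟨0, fun x ↦ by simp⟩
  add_mem' := by
    rintro ω ω' ⟨C, hC⟩ ⟨C', hC'⟩
    refine ⟨C + C', fun x ↦ ?_⟩
    rw [map_add, add_mul]
    exact (norm_add_le _ _).trans (add_le_add (hC x) (hC' x))
  smul_mem' := by
    rintro c ω ⟨C, hC⟩
    refine ⟨‖c‖ * C, fun x ↦ ?_⟩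
    rw [map_smul, norm_smul, mul_assoc]
    exact mul_le_mul_of_nonneg_left (hC x) (norm_nonneg c)

/-- The evaluation `x ↦ x ω` on `M`. -/
def evalAt (M : VonNeumannAlgebra K) (ω : K) : M →ₗ[ℂ] K where
  toFun x := (x : K →L[ℂ] K) ω
  map_add' _ _ := rfl
  map_smul' _ _ := rfl

/-- The bounded operator `L²(M, τ) → K` that extends `x ξ ↦ x ω`. -/
def evalL2 (τ : M →ₚ[ℂ] ℂ) (ω : K) : τ.GNS →L[ℂ] K :=
  (evalAt M ω).extendOfNorm (toL2 τ)

theorem evalL2_toL2 {τ : M →ₚ[ℂ] ℂ} {ω : K} (hω : ω ∈ boundedVectors τ) (x : M) :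
    evalL2 τ ω (toL2 τ x) = (x : K →L[ℂ] K) ω :=
  LinearMap.extendOfNorm_eq (f := evalAt M ω) (denseRange_toL2 τ) hω x

theorem commutant_mem_boundedVectors {τ : M →ₚ[ℂ] ℂ} {ω : K} (hω : ω ∈ boundedVectors τ)
    {T : K →L[ℂ] K} (hT : T ∈ M.commutant) : T ω ∈ boundedVectors τ := by
  obtain ⟨C, hC⟩ := hω
  refine ⟨‖T‖ * C, fun x ↦ ?_⟩
  rw [← mul_apply_eq_comp, mem_commutant_iff.1 hT x x.2, mul_apply_eq_comp, mul_assoc]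
  exact (T.le_opNorm _).trans (mul_le_mul_of_nonneg_left (hC x) (norm_nonneg T))

theorem evalL2_commutant {τ : M →ₚ[ℂ] ℂ} {ω : K} (hω : ω ∈ boundedVectors τ)
    {T : K →L[ℂ] K} (hT : T ∈ M.commutant) (v : τ.GNS) :
    evalL2 τ (T ω) v = T (evalL2 τ ω v) := by
  suffices h : evalL2 τ (T ω) = T ∘L evalL2 τ ω from DFunLike.congr_fun h v
  refine ext_toL2 fun x ↦ ?_
  rw [evalL2_toL2 (commutant_mem_boundedVectors hω hT), ContinuousLinearMap.comp_apply,
    evalL2_toL2 hω, ← mul_apply_eq_comp, mem_commutant_iff.1 hT x x.2, mul_apply_eq_comp]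

/-! ### Normality: an amplification of `K` controls `L²(M, τ)` -/

section Amplification

variable {H : Type*} [NormedAddCommGroup H] [InnerProductSpace ℂ H]

/-- The diagonal action of a bounded operator on `ℓ²(ℕ, H)`. -/
def amplify (T : H →L[ℂ] H) : lp (fun _ : ℕ ↦ H) 2 →ₗ[ℂ] lp (fun _ : ℕ ↦ H) 2 where
  toFun f := ⟨fun n ↦ T (f n), by
    have h := (lp.memℓp f).summable (by norm_num)
    refine memℓp_gen ((h.mul_left (‖T‖ ^ (2 : ENNReal).toReal)).of_nonneg_of_le
      (fun n ↦ by positivity) fun n ↦ ?_)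
    rw [← Real.mul_rpow (norm_nonneg _) (norm_nonneg _)]
    exact Real.rpow_le_rpow (norm_nonneg _) (T.le_opNorm _) (by norm_num)⟩
  map_add' f g := by ext n; exact map_add T _ _
  map_smul' c f := by ext n; exact map_smul T c _

theorem amplify_apply (T : H →L[ℂ] H) (f : lp (fun _ : ℕ ↦ H) 2) (n : ℕ) :
    amplify T f n = T (f n) := rfl

theorem inner_amplify [CompleteSpace H] (T : H →L[ℂ] H) (f g : lp (fun _ : ℕ ↦ H) 2) :
    ⟪f, amplify T g⟫_ℂ = ⟪amplify (star T) f, g⟫_ℂ := by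
  rw [lp.inner_eq_tsum, lp.inner_eq_tsum]
  refine tsum_congr fun n ↦ ?_
  rw [amplify_apply, amplify_apply, ContinuousLinearMap.star_eq_adjoint,
    ContinuousLinearMap.adjoint_inner_left]

theorem continuous_amplify (T : H →L[ℂ] H) : Continuous (amplify T) := by
  refine AddMonoidHomClass.continuous_of_bound (amplify T) ‖T‖ fun f ↦ ?_
  refine lp.norm_le_of_forall_sum_le (by norm_num) (by positivity) fun s ↦ ?_
  calc ∑ n ∈ s, ‖amplify T f n‖ ^ (2 : ENNReal).toReal
      ≤ ∑ n ∈ s, ‖T‖ ^ (2 : ENNReal).toReal * ‖f n‖ ^ (2 : ENNReal).toReal := by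
        refine Finset.sum_le_sum fun n _ ↦ ?_
        rw [← Real.mul_rpow (norm_nonneg _) (norm_nonneg _)]
        exact Real.rpow_le_rpow (norm_nonneg _) (T.le_opNorm _) (by norm_num)
    _ ≤ (‖T‖ * ‖f‖) ^ (2 : ENNReal).toReal := by
        rw [← Finset.mul_sum, Real.mul_rpow (norm_nonneg _) (norm_nonneg _)]
        gcongr
        exact lp.sum_rpow_le_norm_rpow (by norm_num) f s

end Amplification

/-- The orbit map `x ↦ (x ⊗ 1) θ` of a vector of `ℓ²(ℕ, K)`. -/
def orbit (M : VonNeumannAlgebra K) (θ : lp (fun _ : ℕ ↦ K) 2) :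
    M →ₗ[ℂ] lp (fun _ : ℕ ↦ K) 2 where
  toFun x := amplify x θ
  map_add' _ _ := rfl
  map_smul' _ _ := rfl

/-- A normal positive functional is dominated by a vector functional on `ℓ²(ℕ, K)`. -/
theorem exists_norm_toL2_le_norm_orbit {τ : M →ₚ[ℂ] ℂ} (hτ : IsNormal τ.toLinearMap) :
    ∃ θ : lp (fun _ : ℕ ↦ K) 2, ∀ x : M, ‖toL2 τ x‖ ≤ ‖orbit M θ x‖ := by
  obtain ⟨η, ζ, hη, hζ, h⟩ := hτ
  have hη' : Memℓp η 2 := memℓp_gen (by simpa using hη)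
  have hζ' : Memℓp ζ 2 := memℓp_gen (by simpa using hζ)
  let a : lp (fun _ : ℕ ↦ K) 2 := ⟨η, hη'⟩
  let b : lp (fun _ : ℕ ↦ K) 2 := ⟨ζ, hζ'⟩
  -- Polarization: `Re ⟪x a, x b⟫ = ‖x (a + b) / 2‖² - ‖x (a - b) / 2‖²`; the negative term is
  -- dropped.
  refine ⟨(2⁻¹ : ℂ) • (a + b), fun x ↦ ?_⟩
  have key : τ (star x * x) = ⟪amplify x a, amplify x b⟫_ℂ := by
    rw [lp.inner_eq_tsum]
    refine (h (star x * x)).tsum_eq.symm.trans (tsum_congr fun n ↦ ?_)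
    change ⟪η n, star (x : K →L[ℂ] K) ((x : K →L[ℂ] K) (ζ n))⟫_ℂ =
      ⟪(x : K →L[ℂ] K) (η n), (x : K →L[ℂ] K) (ζ n)⟫_ℂ
    rw [ContinuousLinearMap.star_eq_adjoint, ContinuousLinearMap.adjoint_inner_right]
  have hx : ‖toL2 τ x‖ ^ 2 = RCLike.re ⟪amplify x a, amplify x b⟫_ℂ := by
    rw [← key, ← inner_toL2, inner_self_eq_norm_sq]
  have hab : orbit M ((2⁻¹ : ℂ) • (a + b)) x = (2⁻¹ : ℂ) • (amplify x a + amplify x b) := by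
    change amplify (x : K →L[ℂ] K) _ = _
    rw [map_smul, map_add]
  rw [← sq_le_sq₀ (norm_nonneg _) (norm_nonneg _), hx, hab, norm_smul, mul_pow]
  have h1 := norm_add_sq (𝕜 := ℂ) (amplify x a) (amplify x b)
  have h2 := norm_sub_sq (𝕜 := ℂ) (amplify x a) (amplify x b)
  have h3 := sq_nonneg ‖amplify (x : K →L[ℂ] K) a - amplify x b‖
  have h4 : ‖(2⁻¹ : ℂ)‖ ^ 2 = 1 / 4 := by norm_num
  rw [h4]
  linarith

/-- There is a sequence of bounded vectors `uₙ` for which the operators `x ξ ↦ x uₙ` separate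
the points of `L²(M, τ)`. -/
theorem exists_separating_boundedVectors {τ : M →ₚ[ℂ] ℂ} (hτ : IsNormal τ.toLinearMap) :
    ∃ u : ℕ → K, (∀ n, u n ∈ boundedVectors τ) ∧
      ∀ v : τ.GNS, (∀ n, evalL2 τ (u n) v = 0) → v = 0 := by
  obtain ⟨θ, hθ⟩ := exists_norm_toL2_le_norm_orbit hτ
  let N : Submodule ℂ (lp (fun _ : ℕ ↦ K) 2) := (LinearMap.range (orbit M θ)).topologicalClosure
  have hN : IsClosed (N : Set (lp (fun _ : ℕ ↦ K) 2)) := Submodule.isClosed_topologicalClosure _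
  have : CompleteSpace N := hN.completeSpace_coe
  have hmem (x : M) : orbit M θ x ∈ N := Submodule.le_topologicalClosure _ ⟨x, rfl⟩
  let e : M →ₗ[ℂ] N := (orbit M θ).codRestrict N hmem
  have he : DenseRange e := by
    intro v
    rw [closure_subtype]
    have hv := v.2
    rw [← SetLike.mem_coe, Submodule.topologicalClosure_coe] at hv
    refine closure_mono ?_ hv
    rintro _ ⟨x, rfl⟩
    exact ⟨e x, ⟨x, rfl⟩, rfl⟩
  let V : N →L[ℂ] τ.GNS := (toL2 τ).extendOfNorm e
  have hV (x : M) : V (e x) = toL2 τ x :=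
    LinearMap.extendOfNorm_eq he ⟨1, fun x ↦ by rw [one_mul]; exact hθ x⟩ x
  -- `V : x θ ↦ x ξ` has dense range and intertwines the actions of `M`, so `W` is injective and
  -- intertwines too. The coordinates of `W ξ` are the required `uₙ`.
  let W : τ.GNS →L[ℂ] N := V.adjoint
  have hW (x : M) (v : τ.GNS) : ⟪orbit M θ x, (W v : lp (fun _ : ℕ ↦ K) 2)⟫_ℂ =
      ⟪toL2 τ x, v⟫_ℂ := by
    rw [← hV, ← ContinuousLinearMap.adjoint_inner_right]
    rfl
  have hinj (v : τ.GNS) (hv : (W v : lp (fun _ : ℕ ↦ K) 2) = 0) : v = 0 :=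
    inner_toL2_eq_zero fun x ↦ by rw [← hW, hv, inner_zero_right]
  have hclosed (x : M) {z : lp (fun _ : ℕ ↦ K) 2} (hz : z ∈ N) : amplify x z ∈ N := by
    rw [← SetLike.mem_coe, Submodule.topologicalClosure_coe] at hz
    refine closure_minimal ?_ (hN.preimage (continuous_amplify (x : K →L[ℂ] K))) hz
    rintro _ ⟨y, rfl⟩
    exact hmem (x * y)
  have hact (x : M) : (W (toL2 τ x) : lp (fun _ : ℕ ↦ K) 2) = amplify x (W (toL2 τ 1)) := by
    let d : N := W (toL2 τ x) - ⟨_, hclosed x (W (toL2 τ 1)).2⟩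
    suffices hd : d = 0 from congrArg Subtype.val (sub_eq_zero.1 hd)
    refine he.eq_zero_of_inner_left ℂ fun y ↦ ?_
    rw [← inner_conj_symm, Submodule.coe_inner]
    change starRingEnd ℂ ⟪orbit M θ y, (W (toL2 τ x) : lp (fun _ : ℕ ↦ K) 2) -
      amplify x (W (toL2 τ 1))⟫_ℂ = 0
    rw [inner_sub_right, inner_amplify, hW]
    change starRingEnd ℂ (_ - ⟪orbit M θ (star x * y),
      (W (toL2 τ 1) : lp (fun _ : ℕ ↦ K) 2)⟫_ℂ) = 0
    rw [hW, inner_toL2, inner_toL2, star_mul, star_star, mul_one, sub_self, map_zero]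
  have hbd (n : ℕ) : (W (toL2 τ 1) : lp (fun _ : ℕ ↦ K) 2) n ∈ boundedVectors τ := by
    refine ⟨‖W‖, fun x ↦ ?_⟩
    rw [← amplify_apply, ← hact]
    exact (lp.norm_apply_le_norm (by norm_num) _ n).trans (W.le_opNorm _)
  refine ⟨fun n ↦ (W (toL2 τ 1) : lp (fun _ : ℕ ↦ K) 2) n, hbd, fun v hv ↦ hinj v ?_⟩
  ext n
  rw [lp.coeFn_zero, Pi.zero_apply, ← hv n]
  have hc : Continuous fun v ↦ (W v : lp (fun _ : ℕ ↦ K) 2) n :=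
    (lp.evalCLM ℂ (fun _ : ℕ ↦ K) 2 n).continuous.comp (continuous_subtype_val.comp W.continuous)
  refine congrFun ((denseRange_toL2 τ).equalizer hc (evalL2 τ _).continuous
    (funext fun x ↦ ?_)) v
  rw [Function.comp_apply, Function.comp_apply, evalL2_toL2 (hbd n), hact, amplify_apply]

/-- The bounded vectors are `M'`-invariant, so the projection `p` onto their closure is in `M`. Now
`1 - p` kills every separating `uₙ`, whence `(1 - p) ξ = 0` and `p = 1` by faithfulness. -/
theorem dense_boundedVectors {τ : M →ₚ[ℂ] ℂ} (hτ : IsFaithfulNormalTrace τ) :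
    Dense (boundedVectors τ : Set K) := by
  obtain ⟨u, hu, hsep⟩ := exists_separating_boundedVectors hτ.normal
  have hinv {T : K →L[ℂ] K} (hT : T ∈ M.commutant) (v : K)
      (hv : v ∈ (boundedVectors τ).topologicalClosure) :
      T v ∈ (boundedVectors τ).topologicalClosure :=
    map_mem_closure (s := (boundedVectors τ : Set K)) T.continuous hv
      fun _ hω ↦ commutant_mem_boundedVectors hω hT
  have hp : (boundedVectors τ).topologicalClosure.starProjection ∈ M := by
    refine mem_of_commutant_comm fun T hT ↦ ?_
    exact (starProjection_comm (hinv hT) (hinv (star_mem hT))).symm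
  let q : M := 1 - ⟨_, hp⟩
  have hq : q = 0 := by
    refine eq_zero_of_toL2_eq_zero hτ (hsep _ fun n ↦ ?_)
    rw [evalL2_toL2 (hu n)]
    change u n - (boundedVectors τ).topologicalClosure.starProjection (u n) = 0
    rw [Submodule.starProjection_eq_self_iff.2 (Submodule.le_topologicalClosure _ (hu n)), sub_self]
  intro v
  have h1 : (boundedVectors τ).topologicalClosure.starProjection = 1 :=
    (congrArg Subtype.val (sub_eq_zero.1 hq)).symm
  have hv : v ∈ (boundedVectors τ).topologicalClosure :=
    Submodule.starProjection_eq_self_iff.1 (by rw [h1]; rfl)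
  rwa [← SetLike.mem_coe, Submodule.topologicalClosure_coe] at hv

/-- Elements of `M` whose vectors lie in `L²(B)` belong to `B`. -/
theorem mem_of_toL2_mem_subL2 {τ : M →ₚ[ℂ] ℂ} (hτ : IsFaithfulNormalTrace τ)
    {B : VonNeumannAlgebra K} {x : M} (hx : toL2 τ x ∈ subL2 τ B) : (x : K →L[ℂ] K) ∈ B := by
  rw [← SetLike.mem_coe, subL2_eq, mem_closure_iff_seq_limit] at hx
  obtain ⟨v, hv, hlim⟩ := hx
  choose b hb hbv using hv
  obtain rfl : (fun n ↦ toL2 τ (b n)) = v := funext hbv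
  have hlim' : Filter.Tendsto (fun n ↦ toL2 τ (star (b n))) Filter.atTop
      (nhds (toL2 τ (star x))) := by
    rw [tendsto_iff_norm_sub_tendsto_zero] at hlim ⊢
    refine hlim.congr fun n ↦ ?_
    rw [← map_sub, ← map_sub, ← star_sub, norm_toL2_star hτ]
  have heval {ω : K} (hω : ω ∈ boundedVectors τ) {y : ℕ → M} {z : M}
      (h : Filter.Tendsto (fun n ↦ toL2 τ (y n)) Filter.atTop (nhds (toL2 τ z))) :
      Filter.Tendsto (fun n ↦ (y n : K →L[ℂ] K) ω) Filter.atTop (nhds ((z : K →L[ℂ] K) ω)) := by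
    simpa only [Function.comp_def, evalL2_toL2 hω] using
      ((evalL2 τ ω).continuous.tendsto _).comp h
  refine mem_of_commutant_comm fun T hT ↦ ?_
  have hD := dense_boundedVectors hτ
  ext ω
  refine congrFun (Continuous.ext_on hD (T * (x : K →L[ℂ] K)).continuous
    ((x : K →L[ℂ] K) * T).continuous fun ω hω ↦ ?_) ω
  rw [← sub_eq_zero]
  -- `T` lies only in `B'`, so `T ω` need not be bounded. Pairing with a bounded `ω'` moves `x`
  -- across as `x*`, where `hlim'` applies.
  refine hD.eq_zero_of_inner_right ℂ fun ω' hω' ↦ ?_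
  rw [inner_sub_right, sub_eq_zero]
  have h1 := (tendsto_const_nhds (x := ω')).inner ((T.continuous.tendsto _).comp (heval hω hlim))
    (𝕜 := ℂ)
  have h2 := (heval hω' hlim').inner (tendsto_const_nhds (x := T ω)) (𝕜 := ℂ)
  have hadj (y : M) : ⟪((star y : M) : K →L[ℂ] K) ω', T ω⟫_ℂ = ⟪ω', (y : K →L[ℂ] K) (T ω)⟫_ℂ :=
    ContinuousLinearMap.adjoint_inner_left _ _ _
  rw [hadj] at h2
  refine tendsto_nhds_unique h1 (h2.congr fun n ↦ ?_)
  rw [hadj, ← mul_apply_eq_comp, mem_commutant_iff.1 hT _ (hb n)]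
  rfl

/-- The image in `L²(M, τ)` of a ball of `M` is closed. -/
theorem exists_toL2_eq_of_mem_closure {τ : M →ₚ[ℂ] ℂ} (hτ : IsFaithfulNormalTrace τ) {r : ℝ}
    {c : τ.GNS} (hc : c ∈ closure (toL2 τ '' {x | ‖x‖ ≤ r})) : ∃ y : M, toL2 τ y = c := by
  have hD := dense_boundedVectors hτ
  have hbound {ω : K} (hω : ω ∈ boundedVectors τ) : ‖evalL2 τ ω c‖ ≤ r * ‖ω‖ := by
    have hcl : IsClosed {v : τ.GNS | ‖evalL2 τ ω v‖ ≤ r * ‖ω‖} :=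
      isClosed_le (evalL2 τ ω).continuous.norm continuous_const
    refine closure_minimal ?_ hcl hc
    rintro _ ⟨x, hx, rfl⟩
    rw [Set.mem_ofPred_eq, evalL2_toL2 hω]
    exact (x : K →L[ℂ] K).le_of_opNorm_le hx ω
  -- The candidate for `y` sends `ω` to the value at `c` of the extension of `x ξ ↦ x ω`; `hbound`
  -- extends it to all of `K`.
  let f : boundedVectors τ →ₗ[ℂ] K :=
    { toFun ω := evalL2 τ ω c
      map_add' ω ω' := by
        suffices h : evalL2 τ (ω + ω' : K) = evalL2 τ ω + evalL2 τ ω' from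
          DFunLike.congr_fun h c
        refine ext_toL2 fun x ↦ ?_
        rw [add_apply, evalL2_toL2 ω.2, evalL2_toL2 ω'.2,
          evalL2_toL2 (add_mem ω.2 ω'.2), map_add]
      map_smul' a ω := by
        suffices h : evalL2 τ (a • ω : K) = a • evalL2 τ ω from DFunLike.congr_fun h c
        refine ext_toL2 fun x ↦ ?_
        rw [smul_apply, evalL2_toL2 ω.2,
          evalL2_toL2 (Submodule.smul_mem _ a ω.2), map_smul] }
  have hDr : DenseRange (boundedVectors τ).subtype := by
    rw [DenseRange, Submodule.coe_subtype, Subtype.range_coe]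
    exact hD
  let y : K →L[ℂ] K := f.extendOfNorm (boundedVectors τ).subtype
  have hy {ω : K} (hω : ω ∈ boundedVectors τ) : y ω = evalL2 τ ω c :=
    LinearMap.extendOfNorm_eq (f := f) hDr ⟨r, fun ω ↦ hbound ω.2⟩ ⟨ω, hω⟩
  have hyM : y ∈ M := by
    refine mem_of_commutant_comm fun T hT ↦ ?_
    ext ω
    refine congrFun (Continuous.ext_on hD (T * y).continuous (y * T).continuous fun ω hω ↦ ?_) ω
    rw [mul_apply_eq_comp, mul_apply_eq_comp, hy hω, hy (commutant_mem_boundedVectors hω hT),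
      evalL2_commutant hω hT]
  refine ⟨⟨y, hyM⟩, ?_⟩
  obtain ⟨u, hu, hsep⟩ := exists_separating_boundedVectors hτ.normal
  rw [← sub_eq_zero]
  refine hsep _ fun n ↦ ?_
  rw [map_sub, evalL2_toL2 (hu n), sub_eq_zero]
  exact hy (hu n)

/-! ### Central vectors -/

/-- Contractions that leave a nonempty set `S` invariant have a common fixed point in the closed
convex hull of `S`, namely its element of least norm. -/
theorem exists_fixed_mem_closure_convexHull {H : Type*} [NormedAddCommGroup H]
    [InnerProductSpace ℂ H] [CompleteSpace H] {S : Set H} (hS : S.Nonempty)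
    {G : Set (H →L[ℂ] H)} (hG : ∀ T ∈ G, ∀ v, ‖T v‖ ≤ ‖v‖) (hGS : ∀ T ∈ G, ∀ v ∈ S, T v ∈ S) :
    ∃ c ∈ closure (convexHull ℝ S), ∀ T ∈ G, T c = c := by
  let _ : InnerProductSpace ℝ H := InnerProductSpace.rclikeToReal ℂ H
  have hconv : Convex ℝ (closure (convexHull ℝ S)) := (convex_convexHull ℝ S).closure
  obtain ⟨c, hc, hmin⟩ := exists_norm_eq_iInf_of_complete_convex
    (hS.convexHull (𝕜 := ℝ)).closure isClosed_closure.isComplete hconv 0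
  refine ⟨c, hc, fun T hT ↦ ?_⟩
  have hTc : T c ∈ closure (convexHull ℝ S) := by
    have hpre : convexHull ℝ S ⊆ T ⁻¹' closure (convexHull ℝ S) :=
      convexHull_min (fun v hv ↦ subset_closure (subset_convexHull ℝ S (hGS T hT v hv)))
        (hconv.linear_preimage (T.toLinearMap.restrictScalars ℝ))
    exact closure_minimal hpre (isClosed_closure.preimage T.continuous) hc
  -- Minimality gives `‖c‖² ≤ Re ⟪c, T c⟫`; with `‖T c‖ ≤ ‖c‖` this forces `‖c - T c‖² ≤ 0`.
  have hle := (norm_eq_iInf_iff_real_inner_le_zero hconv hc).1 hmin _ hTc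
  rw [zero_sub, inner_neg_left, inner_sub_right, real_inner_self_eq_norm_sq] at hle
  have hsq := norm_sub_sq_real c (T c)
  have hn : ‖T c‖ ^ 2 ≤ ‖c‖ ^ 2 := by
    gcongr
    exact hG T hT c
  have h0 : ‖c - T c‖ ^ 2 = 0 := le_antisymm (by linarith) (sq_nonneg _)
  exact (sub_eq_zero.1 (norm_eq_zero.1 (pow_eq_zero_iff two_ne_zero |>.1 h0))).symm

theorem norm_le_one_of_star_mul_self {u : M} (hu : star u * u = 1) : ‖u‖ ≤ 1 := by
  have h : ‖u‖ * ‖u‖ ≤ 1 := by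
    rw [← CStarRing.norm_star_mul_self, hu]
    exact ContinuousLinearMap.norm_id_le
  nlinarith [norm_nonneg u]

theorem norm_rightMul_apply_le {τ : M →ₚ[ℂ] ℂ} (hτ : IsFaithfulNormalTrace τ) (b : M)
    (v : τ.GNS) : ‖rightMul τ b v‖ ≤ ‖b‖ * ‖v‖ :=
  LinearMap.norm_extendOfNorm_apply_le (f := toL2 τ ∘ₗ LinearMap.mulRight ℂ b)
    (denseRange_toL2 τ) ‖b‖ (fun x ↦ norm_toL2_mul_right_le hτ x b) v

/-- Conjugation by a unitary is contractive on `L²(M, τ)`. -/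
theorem norm_conj_apply_le {τ : M →ₚ[ℂ] ℂ} (hτ : IsFaithfulNormalTrace τ) {u : M}
    (hu : star u * u = 1) (v : τ.GNS) :
    ‖(τ.gnsStarAlgHom u * rightMul τ (star u)) v‖ ≤ ‖v‖ := by
  have h1 : ‖u‖ ≤ 1 := norm_le_one_of_star_mul_self hu
  have h2 : ‖τ.gnsStarAlgHom u‖ ≤ 1 :=
    (NonUnitalStarAlgHom.norm_apply_le τ.gnsStarAlgHom u).trans h1
  rw [mul_apply_eq_comp]
  refine ((τ.gnsStarAlgHom u).le_of_opNorm_le h2 _).trans ?_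
  rw [one_mul]
  refine (norm_rightMul_apply_le hτ _ v).trans ?_
  rw [norm_star]
  exact mul_le_of_le_one_left (norm_nonneg v) h1

/-- An operator that commutes with the unitaries of `B` commutes with `B`. -/
theorem mem_commutant_of_unitary {B : VonNeumannAlgebra K} {y : K →L[ℂ] K}
    (h : ∀ u ∈ B, star u * u = 1 → u * star u = 1 → u * y = y * u) : y ∈ B.commutant := by
  rw [mem_commutant_iff]
  intro b hb
  have hspan : (⟨b, hb⟩ : B) ∈ Submodule.span ℂ (unitary B : Set B) := by
    rw [CStarAlgebra.span_unitary]
    trivial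
  refine Submodule.span_induction (p := fun (x : B) _ ↦ (x : K →L[ℂ] K) * y = y * x)
    (fun u hu ↦ ?_) ?_ (fun x z _ _ hx hz ↦ ?_) (fun c x _ hx ↦ ?_) hspan
  · exact h u u.2 (congrArg Subtype.val (Unitary.star_mul_self_of_mem hu))
      (congrArg Subtype.val (Unitary.mul_star_self_of_mem hu))
  · exact (zero_mul y).trans (mul_zero y).symm
  · change ((x : K →L[ℂ] K) + z) * y = y * (x + z)
    rw [add_mul, mul_add, hx, hz]
  · change (c • (x : K →L[ℂ] K)) * y = y * (c • x)
    rw [smul_mul_assoc, mul_smul_comm, hx]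

theorem convex_toL2_image_closedBall (τ : M →ₚ[ℂ] ℂ) (r : ℝ) :
    Convex ℝ (toL2 τ '' {x | ‖x‖ ≤ r}) := by
  rintro _ ⟨x, hx, rfl⟩ _ ⟨y, hy, rfl⟩ a b ha hb hab
  refine ⟨(a : ℂ) • x + (b : ℂ) • y, ?_, ?_⟩
  · change ‖(a : ℂ) • x + (b : ℂ) • y‖ ≤ r
    refine (norm_add_le _ _).trans ?_
    rw [norm_smul, norm_smul, Complex.norm_of_nonneg ha, Complex.norm_of_nonneg hb]
    calc a * ‖x‖ + b * ‖y‖ ≤ a * r + b * r := by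
          gcongr
          exacts [hx, hy]
      _ = r := by rw [← add_mul, hab, one_mul]
  · rw [map_add, map_smul, map_smul]
    rfl

/-- The `B`-central vectors of `L²(M, τ)` are limits of vectors of `B' ∩ M`. -/
theorem mem_closure_of_central {τ : M →ₚ[ℂ] ℂ} (hτ : IsFaithfulNormalTrace τ)
    {B : VonNeumannAlgebra K} (hBM : B ≤ M) {v : τ.GNS}
    (hv : ∀ b : M, (b : K →L[ℂ] K) ∈ B → τ.gnsStarAlgHom b v = rightMul τ b v) :
    v ∈ closure (toL2 τ '' {x | (x : K →L[ℂ] K) ∈ B.commutant}) := by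
  rw [Metric.mem_closure_iff]
  intro ε hε
  obtain ⟨x, hx⟩ := (denseRange_toL2 τ).exists_dist_lt v hε
  let U : Set M := {u | (u : K →L[ℂ] K) ∈ B ∧ star u * u = 1 ∧ u * star u = 1}
  let S : Set τ.GNS := (fun u : M ↦ toL2 τ (u * x * star u)) '' U
  let Ad (u : M) : τ.GNS →L[ℂ] τ.GNS := τ.gnsStarAlgHom u * rightMul τ (star u)
  have hAd (u y : M) : Ad u (toL2 τ y) = toL2 τ (u * y * star u) := by
    rw [mul_apply_eq_comp, rightMul_toL2 hτ, gnsStarAlgHom_toL2, mul_assoc]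
  have hU1 : (1 : M) ∈ U := ⟨one_mem B, by simp, by simp⟩
  obtain ⟨c, hc, hfix⟩ := exists_fixed_mem_closure_convexHull (S := S) (G := Ad '' U)
    ⟨_, 1, hU1, rfl⟩
    (by rintro _ ⟨u, hu, rfl⟩ w; exact norm_conj_apply_le hτ hu.2.1 w)
    (by
      rintro _ ⟨w, hw, rfl⟩ _ ⟨u, hu, rfl⟩
      refine ⟨w * u, ⟨mul_mem hw.1 hu.1, ?_, ?_⟩, ?_⟩
      · rw [star_mul, mul_assoc, ← mul_assoc (star w), hw.2.1, one_mul, hu.2.1]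
      · rw [star_mul, mul_assoc, ← mul_assoc u, hu.2.2, one_mul, hw.2.2]
      · rw [hAd]
        simp only [star_mul, mul_assoc])
  -- The averages stay in the ball of radius `‖x‖` of `M`, so their limit `c` is again some `y ξ`.
  have hball : c ∈ closure (toL2 τ '' {y | ‖y‖ ≤ ‖x‖}) := by
    refine closure_mono (convexHull_min ?_ (convex_toL2_image_closedBall τ ‖x‖)) hc
    rintro _ ⟨u, hu, rfl⟩
    refine ⟨_, ?_, rfl⟩
    have h1 : ‖u‖ ≤ 1 := norm_le_one_of_star_mul_self hu.2.1
    calc ‖u * x * star u‖ ≤ ‖u‖ * ‖x‖ * ‖star u‖ :=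
          (norm_mul_le _ _).trans (by gcongr; exact norm_mul_le _ _)
      _ ≤ 1 * ‖x‖ * 1 := by rw [norm_star]; gcongr
      _ = ‖x‖ := by rw [one_mul, mul_one]
  -- Conjugations fix the central vector `v` and are contractive, so averaging does not move `x ξ`
  -- away from `v`.
  have hdist : c ∈ Metric.closedBall v (dist (toL2 τ x) v) := by
    refine closure_minimal (convexHull_min ?_ (convex_closedBall _ _)) Metric.isClosed_closedBall hc
    rintro _ ⟨u, hu, rfl⟩
    have huv : Ad u v = v := by
      rw [mul_apply_eq_comp, ← hv (star u) (star_mem hu.1), ← mul_apply_eq_comp, ← map_mul,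
        hu.2.2, map_one]
      rfl
    rw [Metric.mem_closedBall, dist_eq_norm, dist_eq_norm]
    change ‖toL2 τ (u * x * star u) - v‖ ≤ _
    rw [← hAd]
    nth_rw 1 [← huv]
    rw [← map_sub]
    exact norm_conj_apply_le hτ hu.2.1 _
  obtain ⟨y, rfl⟩ := exists_toL2_eq_of_mem_closure hτ hball
  refine ⟨_, ⟨y, mem_commutant_of_unitary fun u hu h1 h2 ↦ ?_, rfl⟩, ?_⟩
  · let w : M := ⟨u, hBM hu⟩
    have hw1 : star w * w = 1 := Subtype.ext h1
    have hfw : toL2 τ (w * y * star w) = toL2 τ y := by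
      rw [← hAd]
      exact hfix _ ⟨w, ⟨hu, hw1, Subtype.ext h2⟩, rfl⟩
    have hwy : w * y * star w = y :=
      sub_eq_zero.1 (eq_zero_of_toL2_eq_zero hτ (by rw [map_sub, hfw, sub_self]))
    have hcomm : w * y = y * w := by
      conv_rhs => rw [← hwy, mul_assoc, hw1, mul_one]
    exact congrArg Subtype.val hcomm
  · rw [dist_comm]
    exact (Metric.mem_closedBall.1 hdist).trans_lt (by rwa [dist_comm])

/-- If `B' ∩ M ⊆ B`, the operators of `B' ∩ ⟨M, e_B⟩` leave `L²(B)` invariant. -/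
theorem relCommutantBasic_apply_mem {τ : M →ₚ[ℂ] ℂ} (hτ : IsFaithfulNormalTrace τ)
    {B : VonNeumannAlgebra K} (hBM : B ≤ M) (h : (B.commutant : Set (K →L[ℂ] K)) ∩ M ⊆ B)
    {t : τ.GNS →L[ℂ] τ.GNS} (ht : t ∈ relCommutantBasic τ B) {x : M}
    (hx : (x : K →L[ℂ] K) ∈ B) : t (toL2 τ x) ∈ subL2 τ B := by
  have hleft {b : M} (hb : (b : K →L[ℂ] K) ∈ B) :
      τ.gnsStarAlgHom b * t = t * τ.gnsStarAlgHom b :=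
    ((StarSubalgebra.mem_centralizer_iff ℂ).1 ht.1 _ ⟨b, hb, rfl⟩).1
  -- `b (t ξ) = t (b ξ) = t (ξ b) = (t ξ) b`.
  have hcentral (b : M) (hb : (b : K →L[ℂ] K) ∈ B) :
      τ.gnsStarAlgHom b (t (toL2 τ 1)) = rightMul τ b (t (toL2 τ 1)) := by
    rw [← mul_apply_eq_comp, ← mul_apply_eq_comp, hleft hb,
      rightMul_comm_basicConstruction hτ hb ht.2, mul_apply_eq_comp, mul_apply_eq_comp,
      gnsStarAlgHom_toL2, rightMul_toL2 hτ, mul_one, one_mul]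
  have hmem : t (toL2 τ 1) ∈ subL2 τ B := by
    rw [← SetLike.mem_coe, subL2_eq]
    exact closure_mono (Set.image_mono fun (y : M) hy ↦ h ⟨hy, y.2⟩)
      (mem_closure_of_central hτ hBM hcentral)
  have htx : t (toL2 τ x) = τ.gnsStarAlgHom x (t (toL2 τ 1)) := by
    rw [← mul_apply_eq_comp, hleft hx, mul_apply_eq_comp, gnsStarAlgHom_toL2, mul_one]
  rw [htx]
  refine map_mem_subL2 (fun y hy ↦ ?_) hmem
  rw [gnsStarAlgHom_toL2]
  exact toL2_mem_subL2 τ (mul_mem hx hy)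

/-- `B' ∩ M` acts on `L²(M, τ)` by operators of `B' ∩ ⟨M, e_B⟩`. -/
theorem gnsStarAlgHom_mem_relCommutantBasic (τ : M →ₚ[ℂ] ℂ) {B : VonNeumannAlgebra K} {x : M}
    (hx : (x : K →L[ℂ] K) ∈ B.commutant) : τ.gnsStarAlgHom x ∈ relCommutantBasic τ B := by
  have hcomm {b : M} (hb : (b : K →L[ℂ] K) ∈ B) :
      τ.gnsStarAlgHom b * τ.gnsStarAlgHom x = τ.gnsStarAlgHom x * τ.gnsStarAlgHom b := by
    rw [← map_mul, ← map_mul]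
    exact congrArg _ (Subtype.ext (mem_commutant_iff.1 hx b hb))
  refine ⟨(StarSubalgebra.mem_centralizer_iff ℂ).2 ?_,
    subset_basicConstruction τ B (Or.inl ⟨x, x.2, rfl⟩)⟩
  rintro _ ⟨b, hb, rfl⟩
  rw [← map_star]
  exact ⟨hcomm hb, hcomm (b := star b) (star_mem hb)⟩

theorem jonesProjection_toL2_of_comm {τ : M →ₚ[ℂ] ℂ} {B : VonNeumannAlgebra K} {x : M}
    (h : jonesProjection τ B * τ.gnsStarAlgHom x = τ.gnsStarAlgHom x * jonesProjection τ B) :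
    jonesProjection τ B (toL2 τ x) = toL2 τ x := by
  have hx : τ.gnsStarAlgHom x (toL2 τ 1) = toL2 τ x := by rw [gnsStarAlgHom_toL2, mul_one]
  have h1 : jonesProjection τ B (toL2 τ 1) = toL2 τ 1 :=
    jonesProjection_eq_self_iff.2 (toL2_one_mem_subL2 τ B)
  calc jonesProjection τ B (toL2 τ x)
      = (jonesProjection τ B * τ.gnsStarAlgHom x) (toL2 τ 1) := by rw [mul_apply_eq_comp, hx]
    _ = toL2 τ x := by rw [h, mul_apply_eq_comp, h1, hx]

end VonNeumannAlgebra

end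

theorem corollary3p3 {K : Type*} [NormedAddCommGroup K] [InnerProductSpace ℂ K] [CompleteSpace K]
    (M : VonNeumannAlgebra K) (τ : M →ₚ[ℂ] ℂ)
    (hτ : VonNeumannAlgebra.IsFaithfulNormalTrace τ)
    (B : VonNeumannAlgebra K) (hBM : B ≤ M) :
    VonNeumannAlgebra.IsCentralIn (VonNeumannAlgebra.jonesProjection τ B)
        (VonNeumannAlgebra.relCommutantBasic τ B) ↔
      (B.commutant : Set (K →L[ℂ] K)) ∩ M ⊆ B := by
  open VonNeumannAlgebra in
  refine ⟨fun ⟨_, hcomm⟩ x ⟨hxB, hxM⟩ ↦ ?_, fun h ↦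
    ⟨jonesProjection_mem_relCommutantBasic τ B, fun t ht ↦ ?_⟩⟩
  · refine mem_of_toL2_mem_subL2 hτ (x := ⟨x, hxM⟩) (jonesProjection_eq_self_iff.1 ?_)
    exact jonesProjection_toL2_of_comm
      (hcomm _ (gnsStarAlgHom_mem_relCommutantBasic τ (x := ⟨x, hxM⟩) hxB))
  · exact jonesProjection_comm (fun x hx ↦ relCommutantBasic_apply_mem hτ hBM h ht hx)
      fun x hx ↦ relCommutantBasic_apply_mem hτ hBM h (star_mem ht) hx
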